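/- \textbf{Setting.} A secondary transmitter (ST) serves $K$ secondary users ($K$ a positive even integer) over a total bandwidth $B>0$; consider one user pair, consisting of a near user $\mathrm n$ and a far user $\mathrm f$ with $N_{\mathrm n},N_{\mathrm f}\ge 1$ receive antennas, which is given the bandwidth $\mathcal B=2B/K$. The channel coefficients are $h_{\mathrm p}=\sqrt{\Omega_{\mathrm p}}\,\hat h_{\mathrm p}$ (ST to primary receiver) and $h_{u,i}=\sqrt{\Omega_u}\,\hat h_{u,i}$ (ST to antenna $i\in\{1,\dots,N_u\}$ of user $u\in\{\mathrm n,\mathrm f\}$), where $\Omega_{\mathrm p},\Omega_{\mathrm n},\Omega_{\mathrm f}>0$ and $\hat h_{\mathrm p}$ and all $\hat h_{u,i}$ are independent $\mathcal{CN}(0,1)$ random variables. Put $g_{\mathrm p}=|h_{\mathrm p}|^2$ and, after maximal-ratio combining, $g_u=\sum_{i=1}^{N_u}|h_{u,i}|^2$. The strong user is the (random) user $\mathrm s=\arg\max_{u\in\{\mathrm n,\mathrm f\}}g_u$, so $g_{\mathrm s}=\max\{g_{\mathrm n},g_{\mathrm f}\}$. The ST knows all these coefficients and transmits with power $I/g_{\mathrm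 p}$, where $I>0$ is the peak tolerable interference power; the power allocation coefficients satisfy $0<a_{\mathrm s}<a_{\mathrm w}$ and $a_{\mathrm s}+a_{\mathrm w}=2/K$. With noise power spectral density $\mathscr N_0>0$, fading block length $T>0$ and delay exponent $\theta>0$, put $\hat I=I/(\mathscr N_0\mathcal B)$, $\nu=\theta T\mathcal B/\ln 2$, $X_{\mathrm s}=g_{\mathrm s}/g_{\mathrm p}$; the SNR of the strong user is $\gamma_{\mathrm s}=a_{\mathrm s}\hat I X_{\mathrm s}$ and its effective rate is $$R_{\mathrm s}=-\frac1\nu\log_2\mathbb E\big[(1+a_{\mathrm s}\hat I X_{\mathrm s})^{-\nu}\big].$$ For integers $k\ge1$ and real $z>0$ write $$G_k(z)=G_{2,2}^{2,2}\Big(z\,\Big|\begin{smallmatrix}-k,&1-k\\0,&\nu-k\end{smallmatrix}\Big)=\frac1{2\pi i}\int_{\sigma-i\infty}^{\sigma+i\infty}\Gamma(-s)\,\Gamma(\nu-k-s)\,\Gamma(1+k+s)\,\Gamma(k+s)\,z^{s}\,ds$$ for this Meijer $G$-function, where $\sigma$ is any real number with $-k<\sigma<\min\{0,\nu-k\}$.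 \textbf{Theorem.} The integrals that define the functions $G_k(z)$ converge absolutely and do not depend on $\sigma$, the expectation above exists, and $$R_{\mathrm s}=-\frac1\nu\log_2\Big[T_1(N_{\mathrm n},\Omega_{\mathrm n})+T_1(N_{\mathrm f},\Omega_{\mathrm f})-T_2(N_{\mathrm n},N_{\mathrm f},\Omega_{\mathrm n},\Omega_{\mathrm f})-T_2(N_{\mathrm f},N_{\mathrm n},\Omega_{\mathrm f},\Omega_{\mathrm n})\Big],$$ where the number in brackets is real and positive and $$T_1(\alpha,\beta)=\frac{1}{\Gamma(\alpha)\Gamma(\nu)}\Big(\frac{\Omega_{\mathrm p}}{\beta a_{\mathrm s}\hat I}\Big)^{\alpha}G_\alpha\Big(\frac{\Omega_{\mathrm p}}{\beta a_{\mathrm s}\hat I}\Big),$$ $$T_2(\alpha_1,\alpha_2,\beta_1,\beta_2)=\sum_{\tau=0}^{\alpha_2-1}\frac{[\Omega_{\mathrm p}/(a_{\mathrm s}\hat I)]^{\alpha_1+\tau}}{\Gamma(\alpha_1)\Gamma(\nu)\,\beta_1^{\alpha_1}\beta_2^{\tau}\,\tau!}\;G_{\alpha_1+\tau}\Big(\frac{\Omega_{\mathrm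 p}}{\Omega a_{\mathrm s}\hat I}\Big),\qquad \Omega=\frac{\Omega_{\mathrm n}\Omega_{\mathrm f}}{\Omega_{\mathrm n}+\Omega_{\mathrm f}}.$$ -/

import Mathlib

open MeasureTheory ProbabilityTheory

noncomputable section

namespace NOMA

/-! ### Meijer's G-function -/

/-- The integrand of the Mellin–Barnes integral that defines
`G_{p,q}^{m,n}(z | a₁,…,a_p ; b₁,…,b_q)`, namely
`∏_{j ≤ m} Γ(b_j - s) ∏_{j ≤ n} Γ(1 - a_j + s) /
  (∏_{j > m} Γ(1 - b_j + s) ∏_{j > n} Γ(a_j - s)) * z ^ s`.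
(`Complex.Gamma` vanishes at its poles, so that the inverses below are the entire function `1/Γ`.) -/
def meijerIntegrand (m n : ℕ) {p q : ℕ} (a : Fin p → ℂ) (b : Fin q → ℂ) (z s : ℂ) : ℂ :=
  (∏ j : Fin q, if (j : ℕ) < m then Complex.Gamma (b j - s) else (Complex.Gamma (1 - b j + s))⁻¹) *
  (∏ j : Fin p, if (j : ℕ) < n then Complex.Gamma (1 - a j + s) else (Complex.Gamma (a j - s))⁻¹) *
  z ^ s

/-- The vertical line `Re s = σ` separates the poles `b_j + k` of `Γ(b_j - s)`, `j ≤ m`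
(on its right), from the poles `a_j - 1 - k` of `Γ(1 - a_j + s)`, `j ≤ n` (on its left). -/
def Separates (m n : ℕ) {p q : ℕ} (a : Fin p → ℂ) (b : Fin q → ℂ) (σ : ℝ) : Prop :=
  (∀ j : Fin q, (j : ℕ) < m → σ < (b j).re) ∧ (∀ j : Fin p, (j : ℕ) < n → (a j).re - 1 < σ)

/-- `(2πi)⁻¹ ∫_{σ - i∞}^{σ + i∞}` of the Mellin–Barnes integrand. -/
def mellinBarnes (m n : ℕ) {p q : ℕ} (a : Fin p → ℂ) (b : Fin q → ℂ) (z : ℂ) (σ : ℝ) : ℂ :=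
  (2 * Real.pi : ℂ)⁻¹ * ∫ t : ℝ, meijerIntegrand m n a b z (σ + t * Complex.I)

open Classical in
/-- Meijer's G-function `G_{p,q}^{m,n}(z | a ; b)`: the Mellin–Barnes integral over a vertical line
that separates the two families of poles (for parameters that admit such a line). -/
def meijerG (m n : ℕ) {p q : ℕ} (a : Fin p → ℂ) (b : Fin q → ℂ) (z : ℂ) : ℂ :=
  if h : ∃ σ : ℝ, Separates m n a b σ then mellinBarnes m n a b z h.choose else 0

/-- `G_{p,q}^{m,n}(z | a ; b)` is properly defined: a separating vertical line exists, and over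
each such line the integral converges absolutely and has the value `meijerG m n a b z`. -/
def MeijerGDefined (m n : ℕ) {p q : ℕ} (a : Fin p → ℂ) (b : Fin q → ℂ) (z : ℂ) : Prop :=
  (∃ σ : ℝ, Separates m n a b σ) ∧
    ∀ σ : ℝ, Separates m n a b σ →
      Integrable (fun t : ℝ => meijerIntegrand m n a b z (σ + t * Complex.I)) ∧
      mellinBarnes m n a b z σ = meijerG m n a b z

/-! ### The system model -/

/-- The circularly symmetric complex normal distribution `CN(0, 1)`, with density
`π⁻¹ exp(-|z|²)`. -/
def stdComplexNormal : Measure ℂ :=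
  volume.withDensity fun z => ENNReal.ofReal (Real.pi⁻¹ * Real.exp (-‖z‖ ^ 2))

/-- The two secondary users of a pair. -/
inductive User
  | near
  | far

/-- The deterministic parameters of the underlay downlink NOMA system, seen from one user pair. -/
structure Params where
  /-- number of secondary users -/
  K : ℕ
  /-- total bandwidth -/
  B : ℝ
  /-- length of a fading block -/
  T : ℝ
  /-- delay QoS exponent -/
  θ : ℝ
  /-- noise power spectral density -/
  N0 : ℝ
  /-- peak tolerable interference power at the primary receiver -/
  I : ℝ
  /-- power allocation coefficient of the strong user -/
  as : ℝ
  /-- power allocation coefficient of the weak user -/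
  aw : ℝ
  /-- path loss of the link to the primary receiver -/
  Ωp : ℝ
  /-- path losses of the links to the two users -/
  Ω : User → ℝ
  /-- numbers of receive antennas of the two users -/
  N : User → ℕ
  K_pos : 0 < K
  K_even : Even K
  B_pos : 0 < B
  T_pos : 0 < T
  θ_pos : 0 < θ
  N0_pos : 0 < N0
  I_pos : 0 < I
  as_pos : 0 < as
  as_lt_aw : as < aw
  as_add_aw : as + aw = 2 / (K : ℝ)
  Ωp_pos : 0 < Ωp
  Ω_pos : ∀ u, 0 < Ω u
  N_pos : ∀ u, 1 ≤ N u

namespace Params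

variable (P : Params)

/-- Bandwidth `2B/K` of the user pair. -/
def pairBandwidth : ℝ := 2 * P.B / (P.K : ℝ)

/-- `ν = θ T 𝓑 / ln 2`, with `𝓑` the bandwidth of the pair. -/
def ν : ℝ := P.θ * P.T * P.pairBandwidth / Real.log 2

/-- `Î = I / (N₀ 𝓑)`. -/
def Ihat : ℝ := P.I / (P.N0 * P.pairBandwidth)

/-- `Ω_n Ω_f / (Ω_n + Ω_f)`. -/
def Ωpair : ℝ := P.Ω .near * P.Ω .far / (P.Ω .near + P.Ω .far)

/-- Transmit power `I / g_p` of the secondary transmitter. -/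
def transmitPower (gp : ℝ) : ℝ := P.I / gp

variable {S : Type*}

/-- Gain `g_p = |h_p|²` of the interference link, where `h_p = √Ω_p ĥ_p`. -/
def gainPrimary (hp : S → ℂ) (s : S) : ℝ := ‖(Real.sqrt P.Ωp : ℂ) * hp s‖ ^ 2

/-- Gain `g_u = ∑ᵢ |h_{u,i}|²` of user `u` after maximal-ratio combining, `h_{u,i} = √Ω_u ĥ_{u,i}`. -/
def gain (h : (u : User) → Fin (P.N u) → S → ℂ) (u : User) (s : S) : ℝ :=
  ∑ i : Fin (P.N u), ‖(Real.sqrt (P.Ω u) : ℂ) * h u i s‖ ^ 2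

open Classical in
/-- The strong user: the one with the larger gain. -/
def strongUser (h : (u : User) → Fin (P.N u) → S → ℂ) (s : S) : User :=
  if P.gain h .far s ≤ P.gain h .near s then .near else .far

/-- SNR of the strong user for its own signal:
`γ_s = a_s P_t(g_p) g_s / (N₀ 𝓑)`. -/
def snrStrong (hp : S → ℂ) (h : (u : User) → Fin (P.N u) → S → ℂ) (s : S) : ℝ :=
  P.as * P.transmitPower (P.gainPrimary hp s) * P.gain h (P.strongUser h s) s /
    (P.N0 * P.pairBandwidth)

/-- Effective rate `-(1/ν) log₂ E[(1 + γ)^{-ν}]` of a user with SNR `γ`. -/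
def effectiveRate [MeasurableSpace S] (μ : Measure S) (γ : S → ℝ) : ℝ :=
  -(1 / P.ν) * Real.logb 2 (∫ s, (1 + γ s) ^ (-P.ν) ∂μ)

/-! ### The closed form -/

/-- `G_{2,2}^{2,2}(z | -k, 1-k ; 0, ν-k)`: upper parameters. -/
def upperPar (k : ℕ) : Fin 2 → ℂ := ![-(k : ℂ), 1 - (k : ℂ)]

/-- `G_{2,2}^{2,2}(z | -k, 1-k ; 0, ν-k)`: lower parameters. -/
def lowerPar (k : ℕ) : Fin 2 → ℂ := ![0, (P.ν : ℂ) - (k : ℂ)]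

/-- `T₁(α, β)`. -/
def T₁ (α : ℕ) (β : ℝ) : ℂ :=
  (((P.Ωp / (β * P.as * P.Ihat)) ^ α / (Real.Gamma α * Real.Gamma P.ν) : ℝ) : ℂ) *
    meijerG 2 2 (upperPar α) (P.lowerPar α) ((P.Ωp / (β * P.as * P.Ihat) : ℝ) : ℂ)

/-- `T₂(α₁, α₂, β₁, β₂)`. -/
def T₂ (α₁ α₂ : ℕ) (β₁ β₂ : ℝ) : ℂ :=
  ∑ τ ∈ Finset.range α₂,
    (((P.Ωp / (P.as * P.Ihat)) ^ (α₁ + τ) /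
        (Real.Gamma α₁ * Real.Gamma P.ν * β₁ ^ α₁ * β₂ ^ τ * (τ.factorial : ℝ)) : ℝ) : ℂ) *
      meijerG 2 2 (upperPar (α₁ + τ)) (P.lowerPar (α₁ + τ))
        ((P.Ωp / (P.Ωpair * P.as * P.Ihat) : ℝ) : ℂ)

end Params

end NOMA

end

/-! After maximal-ratio combining, the user gains are independent Erlang variables of shape `N u`
and rate `1/Ω u`, and the primary gain is an independent exponential variable. The proof rests on
two computations.

Reduction to one gain. Averaging over the primary gain leaves a function φ (`condMean`) of the
larger user gain. Splitting by which user is stronger gives E φ(max(X,Y)) = E[φ(X) F_Y(X)] + E[φ(Y)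
F_X(Y)] (`integral_comp_max_prod`). The Erlang distribution function is 1 minus a finite sum of
terms e^{-rx}(rx)^τ/τ!, and such a term times a gamma density is a multiple of the gamma density of
larger shape and summed rate (`integral_mul_gammaMeasure_Iic`). Hence only the means `meanRatio` for
a single gamma gain remain: the 1 yields T₁, the sum yields T₂.

Single gain as a Meijer G. Mellin inversion writes Γ(ν)(1+x)^{-ν} as a vertical line integral of
Γ(u)Γ(ν-u)x^{-u} (`one_add_rpow_neg_eq_integral`). Inserting the ratio of gains for x and applying
Fubini replaces the powers by gamma moments, which supply the two other Γ factors
(`integral_gammaRatio_eq_mellinBarnes`). The shift u = s + k gives the Meijer integrand. Since this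
works on every admissible line with the same expectation as result, independence of σ needs no
contour shift. -/

/-! ### Integration and complex moments under gamma laws -/

theorem integrable_gammaMeasure_iff {E : Type*} [NormedAddCommGroup E] [NormedSpace ℝ E]
    {a r : ℝ} (ha : 0 < a) (hr : 0 < r) {f : ℝ → E} :
    Integrable f (gammaMeasure a r) ↔
      IntegrableOn (fun x => (r ^ a / Real.Gamma a * x ^ (a - 1) * Real.exp (-(r * x))) • f x)
        (Set.Ioi 0) := by
  rw [gammaMeasure, integrable_withDensity_iff_integrable_smul'
    (f := gammaPDF a r) (measurable_gammaPDFReal a r).ennreal_ofReal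
    (ae_of_all _ fun _ => ENNReal.ofReal_lt_top),
    ← integrableOn_Ici_iff_integrableOn_Ioi, ← integrable_indicator_iff measurableSet_Ici]
  refine integrable_congr (ae_of_all _ fun x => ?_)
  simp only [gammaPDF, ENNReal.toReal_ofReal (gammaPDFReal_nonneg ha hr x)]
  by_cases hx : 0 ≤ x <;> simp [gammaPDFReal, Set.indicator, hx]

theorem integral_gammaMeasure {E : Type*} [NormedAddCommGroup E] [NormedSpace ℝ E]
    {a r : ℝ} (ha : 0 < a) (hr : 0 < r) (f : ℝ → E) :
    ∫ x, f x ∂gammaMeasure a r =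
      ∫ x in Set.Ioi 0, (r ^ a / Real.Gamma a * x ^ (a - 1) * Real.exp (-(r * x))) • f x := by
  rw [gammaMeasure, integral_withDensity_eq_integral_toReal_smul
    (f := gammaPDF a r) (measurable_gammaPDFReal a r).ennreal_ofReal
    (ae_of_all _ fun _ => ENNReal.ofReal_lt_top),
    ← integral_Ici_eq_integral_Ioi, ← integral_indicator measurableSet_Ici]
  refine integral_congr_ae (ae_of_all _ fun x => ?_)
  simp only [gammaPDF, ENNReal.toReal_ofReal (gammaPDFReal_nonneg ha hr x)]
  by_cases hx : 0 ≤ x <;> simp [gammaPDFReal, Set.indicator, hx]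

theorem ae_pos_gammaMeasure (a r : ℝ) : ∀ᵐ x ∂gammaMeasure a r, 0 < x := by
  have h : gammaMeasure a r (Set.Iio 0) = 0 := by
    rw [gammaMeasure, withDensity_apply _ measurableSet_Iio]
    exact lintegral_gammaPDF_of_nonpos le_rfl
  have h0 : gammaMeasure a r {0} = 0 := withDensity_absolutelyContinuous _ _ (by simp)
  rw [ae_iff]
  refine measure_mono_null (t := Set.Iio 0 ∪ {0}) (fun x hx => ?_) (measure_union_null h h0)
  simpa [le_iff_lt_or_eq] using hx

theorem integrable_cpow_gammaMeasure {a r : ℝ} (ha : 0 < a) (hr : 0 < r) {w : ℂ}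
    (hw : 0 < a + w.re) : Integrable (fun x : ℝ => (x : ℂ) ^ w) (gammaMeasure a r) := by
  rw [integrable_gammaMeasure_iff ha hr]
  have h1 : IntegrableOn
      (fun x : ℝ => r ^ a / Real.Gamma a * (x ^ (a + w.re - 1) * Real.exp (-(r * x))))
      (Set.Ioi 0) := by
    refine Integrable.const_mul (.of_integral_ne_zero ?_) _
    rw [Real.integral_rpow_mul_exp_neg_mul_Ioi hw hr]
    have := Real.Gamma_pos_of_pos hw
    positivity
  refine Integrable.mono' h1 ?_ ?_
  · exact Measurable.aestronglyMeasurable (by fun_prop)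
  · filter_upwards [ae_restrict_mem measurableSet_Ioi] with x hx
    have hx : 0 < x := hx
    have hG := Real.Gamma_pos_of_pos ha
    rw [norm_smul, Complex.norm_cpow_eq_rpow_re_of_pos hx, Real.norm_of_nonneg (by positivity),
      show a + w.re - 1 = (a - 1) + w.re by ring, Real.rpow_add hx]
    exact le_of_eq (by ring)

theorem integral_cpow_gammaMeasure {a r : ℝ} (ha : 0 < a) (hr : 0 < r) {w : ℂ}
    (hw : 0 < a + w.re) : ∫ x : ℝ, (x : ℂ) ^ w ∂gammaMeasure a r =
      (r : ℂ) ^ (-w) * Complex.Gamma (a + w) / Complex.Gamma a := by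
  have hr' : (r : ℂ) ≠ 0 := by exact_mod_cast hr.ne'
  have key := Complex.integral_cpow_mul_exp_neg_mul_Ioi (a := a + w) (r := r) (by simpa using hw)
    (by simpa using hr)
  rw [integral_gammaMeasure ha hr]
  calc _ = ∫ x : ℝ in Set.Ioi 0, ((r : ℂ) ^ (a : ℂ) / Complex.Gamma a) *
          ((x : ℂ) ^ (a + w - 1) * Complex.exp (-r * x)) := by
        refine setIntegral_congr_fun measurableSet_Ioi fun x hx => ?_
        have hx : 0 < x := hx
        have hx' : (x : ℂ) ≠ 0 := by exact_mod_cast hx.ne'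
        simp only [Complex.real_smul]
        push_cast [Complex.ofReal_cpow hr.le, Complex.ofReal_cpow hx.le, Complex.Gamma_ofReal]
        rw [show (a : ℂ) + w - 1 = (a - 1) + w by ring, Complex.cpow_add _ _ hx', neg_mul]
        ring
    _ = _ := by
        simp only [neg_mul] at key ⊢
        rw [integral_const_mul, key, one_div, Complex.inv_cpow _ _
          (by rw [Complex.arg_ofReal_of_nonneg hr.le]; exact Real.pi_pos.ne), ← Complex.cpow_neg,
          neg_add, Complex.cpow_add _ _ hr', Complex.cpow_neg, Complex.cpow_neg]
        have : (r : ℂ) ^ (a : ℂ) ≠ 0 := by simp [Complex.cpow_eq_zero_iff, hr']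
        field_simp

/-! ### The Gamma function on vertical lines -/

theorem Complex.norm_Gamma_le_Gamma_re {s : ℂ} (hs : 0 < s.re) :
    ‖Complex.Gamma s‖ ≤ Real.Gamma s.re := by
  rw [Complex.Gamma_eq_integral hs, Real.Gamma_eq_integral hs]
  refine (norm_integral_le_integral_norm _).trans (le_of_eq ?_)
  refine setIntegral_congr_fun measurableSet_Ioi fun x hx => ?_
  have hx : 0 < x := hx
  simp only [norm_mul, Complex.norm_cpow_eq_rpow_re_of_pos hx, Complex.norm_real,
    Real.norm_of_nonneg (Real.exp_pos _).le, Complex.sub_re, Complex.one_re]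

theorem Complex.continuous_Gamma_comp {X : Type*} [TopologicalSpace X] {f : X → ℂ}
    (hf : Continuous f) (hpos : ∀ x, 0 < (f x).re) : Continuous fun x => Complex.Gamma (f x) := by
  refine continuous_iff_continuousAt.2 fun x => ?_
  refine ContinuousAt.comp (f := f) (Complex.differentiableAt_Gamma _ fun m h => ?_).continuousAt
    hf.continuousAt
  have := hpos x
  rw [h] at this
  simp only [Complex.neg_re, Complex.natCast_re] at this
  linarith [m.cast_nonneg (α := ℝ)]

/-- No Stirling estimate is needed: using Γ(u+1) = uΓ(u) twice gives |Γ(u)| ≤ Γ(c+2)/|u(u+1)|, which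
decays quadratically, and the other factor is merely bounded by Γ(ν-c). -/
theorem integrable_Gamma_mul_Gamma_vertical {c ν : ℝ} (hc : 0 < c) (hcν : c < ν) :
    Integrable fun t : ℝ =>
      Complex.Gamma (c + t * Complex.I) * Complex.Gamma (ν - (c + t * Complex.I)) := by
  -- This choice makes d²(1+t²) ≤ c²+t² = |u|², so the majorant is a multiple of 1/(1+t²).
  set d := min c 1 with hd
  have hd0 : 0 < d := lt_min hc one_pos
  have hdc : d ≤ c := min_le_left _ _
  have hd1 : d ≤ 1 := min_le_right _ _
  refine Integrable.mono' (integrable_inv_one_add_sq.const_mul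
    (Real.Gamma (c + 2) * Real.Gamma (ν - c) * (d ^ 2)⁻¹)) ?_ (ae_of_all _ fun t => ?_)
  · refine Continuous.aestronglyMeasurable (Continuous.mul ?_ ?_) <;>
      refine Complex.continuous_Gamma_comp (by fun_prop) fun t => ?_ <;> simp [hc, hcν]
  · set u : ℂ := c + t * Complex.I with hu
    have hre : u.re = c := by simp [hu]
    have him : u.im = t := by simp [hu]
    have hu0 : u ≠ 0 := fun h => by rw [h] at hre; simp at hre; linarith
    have hu1 : u + 1 ≠ 0 := fun h => by
      have := congrArg Complex.re h; simp [hre] at this; linarith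
    have e1 := Complex.Gamma_add_one _ hu0
    have e2 := Complex.Gamma_add_one _ hu1
    have h1 : ‖Complex.Gamma (u + 1 + 1)‖ ≤ Real.Gamma (c + 2) := by
      have := Complex.norm_Gamma_le_Gamma_re (s := u + 1 + 1) (by simp [hre]; linarith)
      simpa [hre, add_assoc, show (1 : ℝ) + 1 = 2 by norm_num] using this
    have h2 : ‖Complex.Gamma (ν - u)‖ ≤ Real.Gamma (ν - c) := by
      simpa [hre] using Complex.norm_Gamma_le_Gamma_re (s := ν - u) (by simp [hre, hcν])
    have n0 : d ^ 2 * (1 + t ^ 2) ≤ ‖u‖ ^ 2 := by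
      rw [← Complex.normSq_eq_norm_sq, Complex.normSq_apply, hre, him]
      nlinarith [mul_self_nonneg t, mul_self_nonneg (t * d), mul_le_mul hdc hdc hd0.le hc.le,
        mul_le_mul hd1 hd1 hd0.le zero_le_one]
    have n1 : ‖u‖ ^ 2 ≤ ‖u + 1‖ * ‖u‖ := by
      rw [sq]
      refine mul_le_mul_of_nonneg_right ?_ (norm_nonneg _)
      refine (sq_le_sq₀ (norm_nonneg _) (norm_nonneg _)).1 ?_
      rw [← Complex.normSq_eq_norm_sq, ← Complex.normSq_eq_norm_sq, Complex.normSq_apply,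
        Complex.normSq_apply]
      simp [hre, him]
      nlinarith
    have hG : 0 ≤ Real.Gamma (ν - c) := (Real.Gamma_pos_of_pos (by linarith)).le
    have hpos : 0 < d ^ 2 * (1 + t ^ 2) := by positivity
    rw [e2, e1, norm_mul, norm_mul, ← mul_assoc] at h1
    rw [norm_mul, mul_assoc, ← mul_inv, ← div_eq_mul_inv, le_div_iff₀ hpos]
    calc _ ≤ ‖Complex.Gamma u‖ * ‖Complex.Gamma (ν - u)‖ * (‖u + 1‖ * ‖u‖) := by
          exact mul_le_mul_of_nonneg_left (n0.trans n1) (by positivity)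
      _ = (‖u + 1‖ * ‖u‖ * ‖Complex.Gamma u‖) * ‖Complex.Gamma (ν - u)‖ := by ring
      _ ≤ _ := by gcongr

/-! ### Mellin transform of (1+x)^{-ν} and its inversion -/

/-- Viewing (1+x)^{-ν} as a gamma mixture of exponentials reduces its Mellin transform to Euler's
integral for Γ. -/
theorem integral_exp_neg_mul_gammaMeasure {ν x : ℝ} (hν : 0 < ν) (hx : 0 ≤ x) :
    ∫ y, Real.exp (-(y * x)) ∂gammaMeasure ν 1 = (1 + x) ^ (-ν) := by
  rw [integral_gammaMeasure hν one_pos]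
  have key := Real.integral_rpow_mul_exp_neg_mul_Ioi hν (show 0 < 1 + x by linarith)
  have hG := (Real.Gamma_pos_of_pos hν).ne'
  calc _ = ∫ y in Set.Ioi 0, (Real.Gamma ν)⁻¹ * (y ^ (ν - 1) * Real.exp (-((1 + x) * y))) := by
        refine setIntegral_congr_fun measurableSet_Ioi fun y hy => ?_
        simp only [Real.one_rpow, smul_eq_mul]
        rw [show -((1 + x) * y) = -(1 * y) + -(y * x) by ring, Real.exp_add]
        ring
    _ = _ := by
        rw [integral_const_mul, key, Real.rpow_neg (by linarith), one_div,
          Real.inv_rpow (by linarith)]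
        field_simp

/-- Integrating the norm in x gives Γ(Re u) y^{-Re u}, a gamma moment that is finite because Re u <
ν. This justifies Fubini for the Mellin transform. -/
theorem integrable_cpow_mul_exp_prod {ν : ℝ} {u : ℂ} (hu : 0 < u.re) (huν : u.re < ν) :
    Integrable (fun p : ℝ × ℝ => (p.1 : ℂ) ^ (u - 1) * (Real.exp (-(p.2 * p.1)) : ℂ))
      ((volume.restrict (Set.Ioi 0)).prod (gammaMeasure ν 1)) := by
  have hν : 0 < ν := hu.trans huν
  have := isProbabilityMeasure_gammaMeasure hν one_pos
  rw [integrable_prod_iff' (Measurable.aestronglyMeasurable (by fun_prop))]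
  have hnorm : ∀ y x : ℝ, 0 < x → ‖(x : ℂ) ^ (u - 1) * (Real.exp (-(y * x)) : ℂ)‖ =
      x ^ (u.re - 1) * Real.exp (-(y * x)) := fun y x hx => by
    rw [norm_mul, Complex.norm_cpow_eq_rpow_re_of_pos hx, Complex.norm_real,
      Real.norm_of_nonneg (Real.exp_pos _).le]
    simp
  constructor
  · filter_upwards [ae_pos_gammaMeasure ν 1] with y hy
    have : IntegrableOn (fun x : ℝ => x ^ (u.re - 1) * Real.exp (-(y * x))) (Set.Ioi 0) := by
      refine .of_integral_ne_zero ?_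
      rw [Real.integral_rpow_mul_exp_neg_mul_Ioi hu hy]
      have := Real.Gamma_pos_of_pos hu
      positivity
    refine Integrable.mono' this (Measurable.aestronglyMeasurable (by fun_prop)) ?_
    filter_upwards [ae_restrict_mem measurableSet_Ioi] with x hx
    exact (hnorm y x hx).le
  · have h := (integrable_cpow_gammaMeasure hν one_pos (w := -u) (by simpa using huν)).norm.mul_const
      (Real.Gamma u.re)
    refine h.congr ?_
    filter_upwards [ae_pos_gammaMeasure ν 1] with y hy
    rw [setIntegral_congr_fun measurableSet_Ioi (fun x hx => hnorm y x hx),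
      Real.integral_rpow_mul_exp_neg_mul_Ioi hu hy, Complex.norm_cpow_eq_rpow_re_of_pos hy,
      one_div, Real.inv_rpow hy.le, Complex.neg_re, Real.rpow_neg hy.le]

theorem mellinConvergent_one_add_rpow_neg {ν : ℝ} {u : ℂ} (hu : 0 < u.re) (huν : u.re < ν) :
    MellinConvergent (fun x : ℝ => (((1 + x) ^ (-ν) : ℝ) : ℂ)) u := by
  have hν : 0 < ν := hu.trans huν
  have := isProbabilityMeasure_gammaMeasure hν one_pos
  refine (integrable_cpow_mul_exp_prod hu huν).integral_prod_left.congr ?_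
  filter_upwards [ae_restrict_mem measurableSet_Ioi] with x hx
  have hx : 0 < x := hx
  simp only [smul_eq_mul]
  rw [integral_const_mul, integral_complex_ofReal, integral_exp_neg_mul_gammaMeasure hν hx.le]

theorem mellin_one_add_rpow_neg {ν : ℝ} {u : ℂ} (hu : 0 < u.re) (huν : u.re < ν) :
    mellin (fun x : ℝ => (((1 + x) ^ (-ν) : ℝ) : ℂ)) u =
      Complex.Gamma u * Complex.Gamma (ν - u) / Complex.Gamma ν := by
  have hν : 0 < ν := hu.trans huν
  have := isProbabilityMeasure_gammaMeasure hν one_pos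
  calc _ = ∫ x in Set.Ioi (0 : ℝ), ∫ y : ℝ, (x : ℂ) ^ (u - 1) * (Real.exp (-(y * x)) : ℂ)
          ∂gammaMeasure ν 1 := by
        refine setIntegral_congr_fun measurableSet_Ioi fun x hx => ?_
        have hx : 0 < x := hx
        simp only [smul_eq_mul]
        rw [integral_const_mul, integral_complex_ofReal,
          integral_exp_neg_mul_gammaMeasure hν hx.le]
    _ = ∫ y : ℝ, (∫ x in Set.Ioi (0 : ℝ), (x : ℂ) ^ (u - 1) * (Real.exp (-(y * x)) : ℂ))
          ∂gammaMeasure ν 1 := integral_integral_swap (integrable_cpow_mul_exp_prod hu huν)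
    _ = ∫ y : ℝ, (y : ℂ) ^ (-u) * Complex.Gamma u ∂gammaMeasure ν 1 := by
        refine integral_congr_ae ?_
        filter_upwards [ae_pos_gammaMeasure ν 1] with y hy
        have key := Complex.integral_cpow_mul_exp_neg_mul_Ioi (a := u) (r := y) hu (by simpa using hy)
        rw [one_div, Complex.inv_cpow _ _ (by
          rw [Complex.arg_ofReal_of_nonneg hy.le]; exact Real.pi_pos.ne), ← Complex.cpow_neg] at key
        rw [← key]
        push_cast
        simp
    _ = _ := by
        rw [integral_mul_const, integral_cpow_gammaMeasure hν one_pos (by simpa using huν)]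
        simp only [Complex.ofReal_one, neg_neg, Complex.one_cpow, one_mul]
        ring_nf

theorem one_add_rpow_neg_eq_integral {c ν x : ℝ} (hc : 0 < c) (hcν : c < ν) (hx : 0 < x) :
    (((1 + x) ^ (-ν) : ℝ) : ℂ) * Complex.Gamma ν = (2 * Real.pi : ℂ)⁻¹ *
      ∫ t : ℝ, Complex.Gamma (c + t * Complex.I) * Complex.Gamma (ν - (c + t * Complex.I)) *
        (x : ℂ) ^ (-(c + t * Complex.I)) := by
  have hG : Complex.Gamma ν ≠ 0 := Complex.Gamma_ne_zero_of_re_pos (by simpa using hc.trans hcν)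
  have hm : ∀ t : ℝ, mellin (fun x : ℝ => (((1 + x) ^ (-ν) : ℝ) : ℂ)) (c + t * Complex.I) =
      Complex.Gamma (c + t * Complex.I) * Complex.Gamma (ν - (c + t * Complex.I)) /
        Complex.Gamma ν := fun t => mellin_one_add_rpow_neg (by simpa) (by simpa)
  have hinv := mellinInv_mellin_eq c (fun x : ℝ => (((1 + x) ^ (-ν) : ℝ) : ℂ)) hx
    (mellinConvergent_one_add_rpow_neg (by simpa) (by simpa))
    (by
      refine ((integrable_Gamma_mul_Gamma_vertical hc hcν).div_const (Complex.Gamma ν)).congr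
        (ae_of_all _ fun t => (hm t).symm))
    (by
      refine Complex.continuous_ofReal.continuousAt.comp ?_
      exact ContinuousAt.rpow_const (by fun_prop) (Or.inl (by linarith)))
  rw [← hinv, mellinInv, Complex.real_smul, mul_assoc, ← integral_mul_const]
  simp only [hm, smul_eq_mul]
  push_cast
  rw [one_div]
  congr 2
  ext t
  field_simp

/-! ### Mellin–Barnes integral for a ratio of gamma variables -/

theorem Complex.ofReal_div_cpow {x y : ℝ} (hx : 0 < x) (hy : 0 < y) (u : ℂ) :
    ((x / y : ℝ) : ℂ) ^ u = (x : ℂ) ^ u * (y : ℂ) ^ (-u) := by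
  rw [div_eq_mul_inv, Complex.ofReal_mul, Complex.mul_cpow_ofReal_nonneg hx.le (by positivity),
    Complex.ofReal_inv, Complex.inv_cpow _ _ (by
      rw [Complex.arg_ofReal_of_nonneg hy.le]; exact Real.pi_pos.ne), Complex.cpow_neg]

theorem ae_pos_prod_gammaMeasure {a₁ r₁ a₂ r₂ : ℝ} (ha₁ : 0 < a₁) (hr₁ : 0 < r₁) (ha₂ : 0 < a₂)
    (hr₂ : 0 < r₂) :
    ∀ᵐ p ∂(gammaMeasure a₁ r₁).prod (gammaMeasure a₂ r₂), 0 < p.1 ∧ 0 < p.2 := by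
  have := isProbabilityMeasure_gammaMeasure ha₁ hr₁
  have := isProbabilityMeasure_gammaMeasure ha₂ hr₂
  exact (Measure.quasiMeasurePreserving_fst.ae (ae_pos_gammaMeasure a₁ r₁)).and
    (Measure.quasiMeasurePreserving_snd.ae (ae_pos_gammaMeasure a₂ r₂))

/-- On the line Re u = c the norms of the powers do not depend on t, so the kernel is dominated by a
product of functions of one variable each. The condition c < a makes the negative moment finite. -/
theorem integrable_gammaRatio_mellin_kernel {a b c ν r₁ r₂ : ℝ} (ha : 0 < a) (hb : 0 < b) (hr₁ : 0 < r₁)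
    (hr₂ : 0 < r₂) (hc : 0 < c) (hca : c < a) (hcν : c < ν) :
    Integrable (fun q : (ℝ × ℝ) × ℝ =>
      (Complex.Gamma (c + q.2 * Complex.I) * Complex.Gamma (ν - (c + q.2 * Complex.I)) *
        (b : ℂ) ^ (-(c + q.2 * Complex.I))) *
      ((q.1.1 : ℂ) ^ (-(c + q.2 * Complex.I)) * (q.1.2 : ℂ) ^ (c + q.2 * Complex.I)))
      (((gammaMeasure a r₁).prod (gammaMeasure 1 r₂)).prod volume) := by
  have := isProbabilityMeasure_gammaMeasure ha hr₁
  have := isProbabilityMeasure_gammaMeasure one_pos hr₂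
  have h1 := (integrable_cpow_gammaMeasure ha hr₁ (w := (-c : ℝ)) (by simpa using hca)).norm
  have h2 := (integrable_cpow_gammaMeasure one_pos hr₂ (w := (c : ℝ)) (by simp; linarith)).norm
  have h3 := (integrable_Gamma_mul_Gamma_vertical hc hcν)
  refine Integrable.mono' ((h1.mul_prod h2).mul_prod (h3.norm.mul_const (b ^ (-c)))) ?_ ?_
  · refine AEStronglyMeasurable.mul (AEStronglyMeasurable.mul ?_ ?_) ?_
    · exact h3.aestronglyMeasurable.comp_snd
    · exact Measurable.aestronglyMeasurable (by fun_prop)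
    · exact Measurable.aestronglyMeasurable (by fun_prop)
  · filter_upwards [Measure.quasiMeasurePreserving_fst.ae
      (ae_pos_prod_gammaMeasure ha hr₁ one_pos hr₂)] with q hq
    simp only [norm_mul, Complex.norm_cpow_eq_rpow_re_of_pos hq.1,
      Complex.norm_cpow_eq_rpow_re_of_pos hq.2, Complex.norm_cpow_eq_rpow_re_of_pos hb]
    simp
    exact le_of_eq (by ring)

theorem integral_gammaRatio_mellin_kernel {a b c ν r₁ r₂ : ℝ} (ha : 0 < a) (hb : 0 < b) (hr₁ : 0 < r₁)
    (hr₂ : 0 < r₂) (hc : 0 < c) (hca : c < a) (t : ℝ) :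
    ∫ p : ℝ × ℝ,
      (Complex.Gamma (c + t * Complex.I) * Complex.Gamma (ν - (c + t * Complex.I)) *
        (b : ℂ) ^ (-(c + t * Complex.I))) *
      ((p.1 : ℂ) ^ (-(c + t * Complex.I)) * (p.2 : ℂ) ^ (c + t * Complex.I))
      ∂((gammaMeasure a r₁).prod (gammaMeasure 1 r₂)) =
    (Complex.Gamma a)⁻¹ * (Complex.Gamma (a - (c + t * Complex.I)) *
      Complex.Gamma (ν - (c + t * Complex.I)) * Complex.Gamma (1 + (c + t * Complex.I)) *
      Complex.Gamma (c + t * Complex.I) * ((r₁ / (b * r₂) : ℝ) : ℂ) ^ (c + t * Complex.I)) := by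
  have := isProbabilityMeasure_gammaMeasure ha hr₁
  have := isProbabilityMeasure_gammaMeasure one_pos hr₂
  set u : ℂ := c + t * Complex.I with hu
  have hre : u.re = c := by simp [hu]
  rw [integral_const_mul,
    integral_prod_mul (μ := gammaMeasure a r₁) (ν := gammaMeasure 1 r₂)
      (fun x : ℝ => (x : ℂ) ^ (-u)) (fun x : ℝ => (x : ℂ) ^ u),
    integral_cpow_gammaMeasure ha hr₁ (by simpa [hre] using hca),
    integral_cpow_gammaMeasure one_pos hr₂ (by rw [hre]; linarith),
    Complex.ofReal_div_cpow hr₁ (mul_pos hb hr₂), Complex.ofReal_mul,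
    Complex.mul_cpow_ofReal_nonneg hb.le hr₂.le]
  simp only [neg_neg, Complex.ofReal_one, Complex.Gamma_one, div_one, ← sub_eq_add_neg]
  ring

/-- Absolute convergence comes from Fubini: up to the factor Γ(a), the integrand is a partial
integral of the integrable kernel. -/
theorem integrable_gammaRatio_mellinBarnes {a b c ν r₁ r₂ : ℝ} (ha : 0 < a) (hb : 0 < b) (hr₁ : 0 < r₁)
    (hr₂ : 0 < r₂) (hc : 0 < c) (hca : c < a) (hcν : c < ν) :
    Integrable fun t : ℝ => Complex.Gamma (a - (c + t * Complex.I)) *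
      Complex.Gamma (ν - (c + t * Complex.I)) * Complex.Gamma (1 + (c + t * Complex.I)) *
      Complex.Gamma (c + t * Complex.I) * ((r₁ / (b * r₂) : ℝ) : ℂ) ^ (c + t * Complex.I) := by
  have := isProbabilityMeasure_gammaMeasure ha hr₁
  have := isProbabilityMeasure_gammaMeasure one_pos hr₂
  have hG : Complex.Gamma a ≠ 0 := Complex.Gamma_ne_zero_of_re_pos (by simpa)
  have h := (integrable_gammaRatio_mellin_kernel ha hb hr₁ hr₂ hc hca hcν).integral_prod_right
  simp only [integral_gammaRatio_mellin_kernel ha hb hr₁ hr₂ hc hca] at h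
  simpa [hG] using h.const_mul (Complex.Gamma a)

theorem integral_gammaRatio_eq_mellinBarnes {a b c ν r₁ r₂ : ℝ} (ha : 0 < a) (hb : 0 < b) (hr₁ : 0 < r₁)
    (hr₂ : 0 < r₂) (hc : 0 < c) (hca : c < a) (hcν : c < ν) :
    ((∫ p : ℝ × ℝ, (1 + b * p.1 / p.2) ^ (-ν)
        ∂((gammaMeasure a r₁).prod (gammaMeasure 1 r₂)) : ℝ) : ℂ) *
      (Complex.Gamma a * Complex.Gamma ν) =
    (2 * Real.pi : ℂ)⁻¹ * ∫ t : ℝ, Complex.Gamma (a - (c + t * Complex.I)) *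
      Complex.Gamma (ν - (c + t * Complex.I)) * Complex.Gamma (1 + (c + t * Complex.I)) *
      Complex.Gamma (c + t * Complex.I) * ((r₁ / (b * r₂) : ℝ) : ℂ) ^ (c + t * Complex.I) := by
  have := isProbabilityMeasure_gammaMeasure ha hr₁
  have := isProbabilityMeasure_gammaMeasure one_pos hr₂
  have hG : Complex.Gamma a ≠ 0 := Complex.Gamma_ne_zero_of_re_pos (by simpa)
  have hswap := integral_integral_swap (f := fun (p : ℝ × ℝ) (t : ℝ) =>
      (Complex.Gamma (c + t * Complex.I) * Complex.Gamma (ν - (c + t * Complex.I)) *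
        (b : ℂ) ^ (-(c + t * Complex.I))) *
      ((p.1 : ℂ) ^ (-(c + t * Complex.I)) * (p.2 : ℂ) ^ (c + t * Complex.I)))
    (integrable_gammaRatio_mellin_kernel ha hb hr₁ hr₂ hc hca hcν)
  simp only [integral_gammaRatio_mellin_kernel ha hb hr₁ hr₂ hc hca, integral_const_mul] at hswap
  have hleft : ((∫ p : ℝ × ℝ, (1 + b * p.1 / p.2) ^ (-ν)
        ∂((gammaMeasure a r₁).prod (gammaMeasure 1 r₂)) : ℝ) : ℂ) * Complex.Gamma ν =
      (2 * Real.pi : ℂ)⁻¹ * ∫ p : ℝ × ℝ, (∫ t : ℝ,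
        (Complex.Gamma (c + t * Complex.I) * Complex.Gamma (ν - (c + t * Complex.I)) *
          (b : ℂ) ^ (-(c + t * Complex.I))) *
        ((p.1 : ℂ) ^ (-(c + t * Complex.I)) * (p.2 : ℂ) ^ (c + t * Complex.I)))
        ∂((gammaMeasure a r₁).prod (gammaMeasure 1 r₂)) := by
    rw [← integral_complex_ofReal, ← integral_mul_const, ← integral_const_mul]
    refine integral_congr_ae ?_
    filter_upwards [ae_pos_prod_gammaMeasure ha hr₁ one_pos hr₂] with p hp
    rw [one_add_rpow_neg_eq_integral hc hcν (div_pos (mul_pos hb hp.1) hp.2)]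
    congr 2
    ext t
    rw [Complex.ofReal_div_cpow (mul_pos hb hp.1) hp.2, Complex.ofReal_mul,
      Complex.mul_cpow_ofReal_nonneg hb.le hp.1.le, neg_neg]
    ring
  rw [mul_comm (Complex.Gamma a), ← mul_assoc, hleft, hswap, mul_assoc, mul_right_comm,
    inv_mul_cancel₀ hG, one_mul]

/-! ### Meijer G-functions as expectations -/

namespace NOMA.Params

variable (P : Params)

theorem pairBandwidth_pos : 0 < P.pairBandwidth :=
  div_pos (mul_pos two_pos P.B_pos) (Nat.cast_pos.2 P.K_pos)

theorem ν_pos : 0 < P.ν :=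
  div_pos (mul_pos (mul_pos P.θ_pos P.T_pos) P.pairBandwidth_pos) (Real.log_pos one_lt_two)

theorem Ihat_pos : 0 < P.Ihat := div_pos P.I_pos (mul_pos P.N0_pos P.pairBandwidth_pos)

theorem Ωpair_pos : 0 < P.Ωpair :=
  div_pos (mul_pos (P.Ω_pos _) (P.Ω_pos _)) (add_pos (P.Ω_pos _) (P.Ω_pos _))

theorem separates_iff (k : ℕ) (σ : ℝ) :
    Separates 2 2 (upperPar k) (P.lowerPar k) σ ↔ -(k : ℝ) < σ ∧ σ < 0 ∧ σ < P.ν - k := by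
  simp only [Separates, upperPar, lowerPar, Fin.forall_fin_two]
  simp
  constructor
  · rintro ⟨⟨h1, h2⟩, h3, h4⟩
    exact ⟨h4, h1, h2⟩
  · rintro ⟨h1, h2, h3⟩
    exact ⟨⟨h2, h3⟩, by linarith, h1⟩

theorem exists_separates {k : ℕ} (hk : 1 ≤ k) :
    ∃ σ, Separates 2 2 (upperPar k) (P.lowerPar k) σ := by
  have hk' : (1 : ℝ) ≤ k := by exact_mod_cast hk
  have hν := P.ν_pos
  obtain ⟨σ, h1, h2⟩ := exists_between (show -(k : ℝ) < min 0 (P.ν - k) by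
    rw [lt_min_iff]; constructor <;> linarith)
  rw [lt_min_iff] at h2
  exact ⟨σ, (P.separates_iff k σ).2 ⟨h1, h2⟩⟩

/-- The substitution u = s + k matches the four Γ factors; the prefactor compensates z^{s+k} = z^s
z^k. -/
theorem meijerIntegrand_eq (k : ℕ) {z : ℝ} (hz : 0 < z) (σ t : ℝ) :
    meijerIntegrand 2 2 (upperPar k) (P.lowerPar k) z (σ + t * Complex.I) =
      ((z ^ k)⁻¹ : ℝ) * (Complex.Gamma ((k : ℝ) - ((σ + k : ℝ) + t * Complex.I)) *
        Complex.Gamma (P.ν - ((σ + k : ℝ) + t * Complex.I)) *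
        Complex.Gamma (1 + ((σ + k : ℝ) + t * Complex.I)) *
        Complex.Gamma ((σ + k : ℝ) + t * Complex.I) *
        (z : ℂ) ^ ((σ + k : ℝ) + t * Complex.I)) := by
  have hz' : (z : ℂ) ≠ 0 := by exact_mod_cast hz.ne'
  have hpow : (z : ℂ) ^ ((σ + k : ℝ) + t * Complex.I) =
      (z : ℂ) ^ (σ + t * Complex.I) * (z : ℂ) ^ k := by
    rw [← Complex.cpow_natCast, ← Complex.cpow_add _ _ hz']
    push_cast
    ring_nf
  rw [hpow]
  simp only [meijerIntegrand, upperPar, lowerPar, Fin.prod_univ_two]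
  simp
  have e1 : (k : ℂ) - (σ + k + t * Complex.I) = -(t * Complex.I) + -σ := by ring
  have e2 : (P.ν : ℂ) - (σ + k + t * Complex.I) = P.ν - k - (σ + t * Complex.I) := by ring
  have e3 : (1 : ℂ) + (σ + k + t * Complex.I) = 1 + k + (σ + t * Complex.I) := by ring
  have e4 : (σ : ℂ) + k + t * Complex.I = k + (σ + t * Complex.I) := by ring
  rw [e1, e2, e3, e4]
  field_simp

/-- The expectation of `(1 + a_s Î g / g_p)^{-ν}` for independent `g ~ Gamma(k, β)`
(shape and scale) and `g_p ~ Exp(Ω_p)`. -/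
noncomputable def meanRatio (k : ℕ) (β : ℝ) : ℝ :=
  ∫ p : ℝ × ℝ, (1 + P.as * P.Ihat * p.1 / p.2) ^ (-P.ν)
    ∂((gammaMeasure k β⁻¹).prod (gammaMeasure 1 P.Ωp⁻¹))

theorem integrable_and_mellinBarnes_eq {k : ℕ} (hk : 1 ≤ k) {β : ℝ} (hβ : 0 < β) {σ : ℝ}
    (hσ : Separates 2 2 (upperPar k) (P.lowerPar k) σ) :
    Integrable (fun t : ℝ => meijerIntegrand 2 2 (upperPar k) (P.lowerPar k)
        ((P.Ωp / (β * P.as * P.Ihat) : ℝ) : ℂ) (σ + t * Complex.I)) ∧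
      mellinBarnes 2 2 (upperPar k) (P.lowerPar k) ((P.Ωp / (β * P.as * P.Ihat) : ℝ) : ℂ) σ =
        (((P.Ωp / (β * P.as * P.Ihat)) ^ k)⁻¹ * (P.meanRatio k β *
          (Real.Gamma k * Real.Gamma P.ν)) : ℝ) := by
  obtain ⟨h1, h2, h3⟩ := (P.separates_iff k σ).1 hσ
  have hk' : (0 : ℝ) < k := by exact_mod_cast hk
  have hb : 0 < P.as * P.Ihat := mul_pos P.as_pos P.Ihat_pos
  have hΩ := P.Ωp_pos
  have hz : 0 < P.Ωp / (β * P.as * P.Ihat) :=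
    div_pos hΩ (mul_pos (mul_pos hβ P.as_pos) P.Ihat_pos)
  have hz' : β⁻¹ / (P.as * P.Ihat * P.Ωp⁻¹) = P.Ωp / (β * P.as * P.Ihat) := by
    have := P.as_pos.ne'
    have := P.Ihat_pos.ne'
    field_simp
  -- The strip -k < σ < min(0, ν-k) becomes 0 < c < min(k, ν).
  have hintegrable := integrable_gammaRatio_mellinBarnes (c := σ + k) (ν := P.ν) hk' hb (inv_pos.2 hβ)
    (inv_pos.2 hΩ) (by linarith) (by linarith) (by linarith)
  have heq := integral_gammaRatio_eq_mellinBarnes (c := σ + k) (ν := P.ν) hk' hb (inv_pos.2 hβ)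
    (inv_pos.2 hΩ) (by linarith) (by linarith) (by linarith)
  rw [hz'] at hintegrable heq
  simp only [mellinBarnes, P.meijerIntegrand_eq k hz σ]
  refine ⟨hintegrable.const_mul _, ?_⟩
  rw [integral_const_mul, mul_left_comm, ← heq, Complex.ofReal_mul, Complex.ofReal_mul,
    Complex.ofReal_mul, Complex.Gamma_ofReal, Complex.Gamma_ofReal, meanRatio]

theorem meijerGDefined {k : ℕ} (hk : 1 ≤ k) {z : ℝ} (hz : 0 < z) :
    MeijerGDefined 2 2 (upperPar k) (P.lowerPar k) (z : ℂ) := by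
  -- With this scale as β the argument Ωp/(β a_s Î) equals z, so every positive z arises from an
  -- expectation.
  have hβ : 0 < P.Ωp / (z * P.as * P.Ihat) :=
    div_pos P.Ωp_pos (mul_pos (mul_pos hz P.as_pos) P.Ihat_pos)
  have hzβ : P.Ωp / (P.Ωp / (z * P.as * P.Ihat) * P.as * P.Ihat) = z := by
    have := P.as_pos.ne'
    have := P.Ihat_pos.ne'
    have := P.Ωp_pos.ne'
    field_simp
  have h := P.exists_separates hk
  refine ⟨h, fun σ hσ => ?_⟩
  have e1 := P.integrable_and_mellinBarnes_eq hk hβ hσ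
  have e2 := P.integrable_and_mellinBarnes_eq hk hβ h.choose_spec
  rw [hzβ] at e1 e2
  refine ⟨e1.1, ?_⟩
  rw [meijerG, dif_pos h, e1.2, e2.2]

theorem T₁_eq_meanRatio {k : ℕ} (hk : 1 ≤ k) {β : ℝ} (hβ : 0 < β) :
    P.T₁ k β = (P.meanRatio k β : ℂ) := by
  have h := P.exists_separates hk
  have hz : 0 < P.Ωp / (β * P.as * P.Ihat) :=
    div_pos P.Ωp_pos (mul_pos (mul_pos hβ P.as_pos) P.Ihat_pos)
  have hG := (Real.Gamma_pos_of_pos P.ν_pos).ne'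
  have hGk := (Real.Gamma_pos_of_pos (show (0 : ℝ) < k by exact_mod_cast hk)).ne'
  rw [T₁, meijerG, dif_pos h, (P.integrable_and_mellinBarnes_eq hk hβ h.choose_spec).2,
    ← Complex.ofReal_mul]
  congr 1
  have := (pow_pos hz k).ne'
  field_simp

theorem T₂_eq_sum_meanRatio {α₁ α₂ : ℕ} (hα : 1 ≤ α₁) {β₁ β₂ : ℝ} (hβ₁ : 0 < β₁) (hβ₂ : 0 < β₂) :
    P.T₂ α₁ α₂ β₁ β₂ = ((∑ τ ∈ Finset.range α₂,
      Real.Gamma (α₁ + τ : ℕ) * P.Ωpair ^ (α₁ + τ) /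
        (Real.Gamma α₁ * β₁ ^ α₁ * β₂ ^ τ * (τ.factorial : ℝ)) * P.meanRatio (α₁ + τ) P.Ωpair :
      ℝ) : ℂ) := by
  rw [T₂, Complex.ofReal_sum]
  refine Finset.sum_congr rfl fun τ _ => ?_
  have hk : 1 ≤ α₁ + τ := by omega
  have hΩ := P.Ωpair_pos
  -- Each mean is turned back into `T₁` at shape α₁+τ and scale `Ωpair`, so that both sides carry
  -- the same G-function and only coefficients remain.
  rw [Complex.ofReal_mul, ← P.T₁_eq_meanRatio hk hΩ, T₁, ← mul_assoc, ← Complex.ofReal_mul]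
  congr 2
  have := (Real.Gamma_pos_of_pos (show (0 : ℝ) < (α₁ + τ : ℕ) by exact_mod_cast hk)).ne'
  have := P.as_pos.ne'
  have := P.Ihat_pos.ne'
  have := (Real.Gamma_pos_of_pos (show (0 : ℝ) < α₁ by exact_mod_cast hα)).ne'
  have := (Real.Gamma_pos_of_pos P.ν_pos).ne'
  simp only [div_pow, mul_pow]
  field_simp

end NOMA.Params

/-! ### Laws of the channel gains -/

theorem nullSingletonClass_gammaMeasure (a r : ℝ) : NullSingletonClass (gammaMeasure a r) :=
  ⟨fun _ => withDensity_absolutelyContinuous _ _ (by simp)⟩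

/-- The derivatives telescope, giving an antiderivative of the Erlang density. A complex w serves
the characteristic function, a real one the distribution function. -/
theorem hasDerivAt_neg_sum_mul_pow_div_factorial {𝕜 : Type*} [RCLike 𝕜] {w : 𝕜} {E : ℝ → 𝕜}
    (hE : ∀ x, HasDerivAt E (-(w * E x)) x) (m : ℕ) (x : ℝ) :
    HasDerivAt (fun x : ℝ => -∑ τ ∈ Finset.range (m + 1),
      E x * ((w * (x : 𝕜)) ^ τ / (τ.factorial : 𝕜)))
      (w * (E x * ((w * (x : 𝕜)) ^ m / (m.factorial : 𝕜)))) x := by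
  have hlin : HasDerivAt (fun x : ℝ => w * (x : 𝕜)) w x := by
    simpa using (RCLike.ofRealCLM (K := 𝕜)).hasDerivAt (x := x) |>.const_mul w
  induction m with
  | zero => simpa using (hE x).fun_neg
  | succ m ih =>
    have h2 := ((hE x).fun_mul
      ((hlin.fun_pow (m + 1)).div_const ((m + 1).factorial : 𝕜))).fun_neg
    have hm : ((m + 1).factorial : 𝕜) = (m + 1) * m.factorial := by
      rw [Nat.factorial_succ]; push_cast; ring
    have hm0 : (m.factorial : 𝕜) ≠ 0 := by exact_mod_cast m.factorial_ne_zero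
    have hm1 : (m : 𝕜) + 1 ≠ 0 := by exact_mod_cast m.succ_ne_zero
    simp_rw [Finset.sum_range_succ _ (m + 1), neg_add]
    refine (ih.fun_add h2).congr_deriv ?_
    simp only [hm, Nat.add_sub_cancel, Nat.cast_add, Nat.cast_one]
    field_simp
    ring

theorem tendsto_exp_neg_mul_mul_pow_atTop {w : ℂ} (hw : 0 < w.re) (m : ℕ) :
    Filter.Tendsto (fun x : ℝ => Complex.exp (-(w * x)) * ((w * x) ^ m / (m.factorial : ℂ)))
      Filter.atTop (nhds 0) := by
  rw [tendsto_zero_iff_norm_tendsto_zero]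
  have h := (tendsto_rpow_mul_exp_neg_mul_atTop_nhds_zero m w.re hw).const_mul
    (‖w‖ ^ m / (m.factorial : ℝ))
  rw [mul_zero] at h
  refine h.congr' ?_
  filter_upwards [Filter.eventually_ge_atTop 0] with x hx
  simp [Complex.norm_exp, Real.rpow_natCast, mul_pow, abs_of_nonneg hx]
  ring

/-- The density times e^{itx} is (r/w)^n times the Erlang density of complex rate w = r - it. The
latter integrates to 1, because its antiderivative runs from -1 at 0 to 0 at infinity. -/
theorem charFun_gammaMeasure_natCast {n : ℕ} (hn : 1 ≤ n) {r : ℝ} (hr : 0 < r) (t : ℝ) :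
    charFun (gammaMeasure n r) t = ((r : ℂ) / (r - t * Complex.I)) ^ n := by
  obtain ⟨m, rfl⟩ : ∃ m, n = m + 1 := ⟨n - 1, by omega⟩
  have hn' : (0 : ℝ) < (m + 1 : ℕ) := by positivity
  have := isProbabilityMeasure_gammaMeasure hn' hr
  set w : ℂ := r - t * Complex.I with hw
  have hre : w.re = r := by simp [hw]
  have hw0 : w ≠ 0 := fun h => by rw [h] at hre; simp at hre; linarith
  have hE : ∀ x : ℝ, HasDerivAt (fun x : ℝ => Complex.exp (-(w * x)))
      (-(w * Complex.exp (-(w * x)))) x := fun x => by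
    have h := ((Complex.ofRealCLM.hasDerivAt (x := x)).const_mul w).fun_neg.cexp
    exact h.congr_deriv (by simp [mul_comm])
  have hEq : Set.EqOn (fun x : ℝ => (r ^ ((m + 1 : ℕ) : ℝ) / Real.Gamma (m + 1 : ℕ) *
        x ^ (((m + 1 : ℕ) : ℝ) - 1) * Real.exp (-(r * x))) • Complex.exp (t * x * Complex.I))
      (fun x : ℝ => (r / w) ^ (m + 1) *
        (w * (Complex.exp (-(w * x)) * ((w * x) ^ m / (m.factorial : ℂ))))) (Set.Ioi 0) := by
    intro x _
    have hm0 : (m.factorial : ℂ) ≠ 0 := by exact_mod_cast m.factorial_ne_zero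
    simp only
    rw [Complex.real_smul, Real.rpow_natCast, Nat.cast_add, Nat.cast_one,
      Real.Gamma_nat_eq_factorial, add_sub_cancel_right, Real.rpow_natCast,
      show -(w * x) = -(r * x) + t * x * Complex.I by rw [hw]; ring, Complex.exp_add]
    push_cast
    rw [mul_pow, div_pow]
    field_simp
    ring
  -- Integrability is inherited from the bounded function e^{itx} under a probability measure, after
  -- removing a nonzero constant.
  have hintegrable : IntegrableOn (fun x : ℝ => w * (Complex.exp (-(w * x)) *
      ((w * x) ^ m / (m.factorial : ℂ)))) (Set.Ioi 0) := by
    have h1 : Integrable (fun x : ℝ => Complex.exp (t * x * Complex.I))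
        (gammaMeasure (m + 1 : ℕ) r) := by
      refine Integrable.of_bound (Continuous.aestronglyMeasurable (by fun_prop)) 1
        (ae_of_all _ fun x => ?_)
      rw [← Complex.ofReal_mul, Complex.norm_exp_ofReal_mul_I]
    rw [integrable_gammaMeasure_iff hn' hr, integrableOn_congr_fun hEq measurableSet_Ioi] at h1
    have hc : ((r : ℂ) / w) ^ (m + 1) ≠ 0 :=
      pow_ne_zero _ (div_ne_zero (by exact_mod_cast hr.ne') hw0)
    simpa [IntegrableOn, integrable_const_mul_iff hc.isUnit] using h1
  have hlim : Filter.Tendsto (fun x : ℝ => -∑ τ ∈ Finset.range (m + 1),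
      Complex.exp (-(w * x)) * ((w * x) ^ τ / (τ.factorial : ℂ))) Filter.atTop (nhds 0) := by
    simpa using (tendsto_finsetSum (Finset.range (m + 1)) fun τ _ =>
      tendsto_exp_neg_mul_mul_pow_atTop (w := w) (by rwa [hre]) τ).neg
  have key := integral_Ioi_of_hasDerivAt_of_tendsto'
    (fun x _ => hasDerivAt_neg_sum_mul_pow_div_factorial hE m x) hintegrable hlim
  rw [charFun_apply_real, integral_gammaMeasure hn' hr, setIntegral_congr_fun measurableSet_Ioi hEq,
    integral_const_mul]
  refine (congrArg (((r : ℂ) / w) ^ (m + 1) * ·) key).trans ?_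
  simp [Finset.sum_range_succ']

theorem hasLaw_sum_gammaMeasure {S : Type*} [MeasurableSpace S] {μ : Measure S}
    [IsProbabilityMeasure μ] {n : ℕ} (hn : 1 ≤ n) {r : ℝ} (hr : 0 < r) {X : Fin n → S → ℝ}
    (hX : ∀ i, HasLaw (X i) (gammaMeasure 1 r) μ) (hind : iIndepFun X μ) :
    HasLaw (fun s => ∑ i, X i s) (gammaMeasure n r) μ where
  aemeasurable := Finset.aemeasurable_fun_sum _ fun i _ => (hX i).aemeasurable
  map_eq := by
    have := isProbabilityMeasure_gammaMeasure (a := n) (by exact_mod_cast hn) hr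
    refine Measure.ext_of_charFun ?_
    rw [hind.charFun_map_fun_sum_eq_prod fun i => (hX i).aemeasurable]
    ext t
    have h1 := charFun_gammaMeasure_natCast le_rfl hr t
    rw [Nat.cast_one] at h1
    simp [(hX _).map_eq, h1, charFun_gammaMeasure_natCast hn hr, div_pow]

theorem isProbabilityMeasure_stdComplexNormal : IsProbabilityMeasure NOMA.stdComplexNormal := by
  have h := GaussianFourier.integral_rexp_neg_mul_sq_norm (V := ℂ) one_pos
  have hi : Integrable (fun z : ℂ => Real.exp (-1 * ‖z‖ ^ 2)) := by
    refine .of_integral_ne_zero ?_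
    rw [h]
    have := Real.pi_pos
    positivity
  refine ⟨?_⟩
  rw [NOMA.stdComplexNormal, withDensity_apply _ MeasurableSet.univ, Measure.restrict_univ,
    ← ofReal_integral_eq_lintegral_ofReal (by simpa using hi.const_mul Real.pi⁻¹)
      (ae_of_all _ fun z => by positivity), integral_const_mul]
  simp only [neg_mul, one_mul] at h
  rw [h]
  simp

/-- The characteristic function is the Gaussian integral of e^{-b|z|²} over the plane, π/b, at b = 1
- itΩ; this avoids polar coordinates. -/
theorem hasLaw_normSq_stdComplexNormal {Ω : ℝ} (hΩ : 0 < Ω) :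
    HasLaw (fun z : ℂ => ‖(Real.sqrt Ω : ℂ) * z‖ ^ 2) (gammaMeasure 1 Ω⁻¹)
      NOMA.stdComplexNormal where
  map_eq := by
    have := isProbabilityMeasure_stdComplexNormal
    have := isProbabilityMeasure_gammaMeasure one_pos (inv_pos.2 hΩ)
    refine Measure.ext_of_charFun ?_
    ext t
    have h1 := charFun_gammaMeasure_natCast le_rfl (inv_pos.2 hΩ) t
    rw [Nat.cast_one, pow_one] at h1
    have key := GaussianFourier.integral_cexp_neg_mul_sq_norm (V := ℂ)
      (b := 1 - t * Ω * Complex.I) (by simp)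
    have hΩ' : (Ω : ℂ) ≠ 0 := by exact_mod_cast hΩ.ne'
    have hne : (1 : ℂ) - t * Ω * Complex.I ≠ 0 := fun h => by
      have := congrArg Complex.re h; simp at this
    rw [h1, charFun_apply_real, integral_map (by fun_prop)
      (Measurable.aestronglyMeasurable (by fun_prop)), NOMA.stdComplexNormal,
      integral_withDensity_eq_integral_toReal_smul (by fun_prop)
        (ae_of_all _ fun _ => ENNReal.ofReal_lt_top)]
    calc _ = ∫ z : ℂ, (Real.pi : ℂ)⁻¹ *
            Complex.exp (-(1 - t * Ω * Complex.I) * (‖z‖ : ℂ) ^ 2) := by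
          refine integral_congr_ae (ae_of_all _ fun z => ?_)
          simp only
          rw [ENNReal.toReal_ofReal (by positivity), Complex.real_smul, norm_mul, mul_pow,
            Complex.norm_real, Real.norm_of_nonneg (Real.sqrt_nonneg _), Real.sq_sqrt hΩ.le]
          push_cast
          rw [mul_assoc, ← Complex.exp_add]
          ring_nf
      _ = _ := by
          rw [integral_const_mul, key, Complex.finrank_real_complex]
          have : (Real.pi : ℂ) ≠ 0 := by exact_mod_cast Real.pi_ne_zero
          have h2 : (Ω : ℂ)⁻¹ - t * Complex.I = (1 - t * Ω * Complex.I) * (Ω : ℂ)⁻¹ := by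
            field_simp
          push_cast
          rw [h2]
          norm_num
          field_simp

/-! ### The maximum of two independent Erlang variables -/

theorem gammaMeasure_natCast_real_Iic {n : ℕ} (hn : 1 ≤ n) {r x : ℝ} (hr : 0 < r) (hx : 0 ≤ x) :
    (gammaMeasure n r).real (Set.Iic x) =
      1 - ∑ τ ∈ Finset.range n, Real.exp (-(r * x)) * ((r * x) ^ τ / (τ.factorial : ℝ)) := by
  obtain ⟨m, rfl⟩ : ∃ m, n = m + 1 := ⟨n - 1, by omega⟩
  have hn' : (0 : ℝ) < (m + 1 : ℕ) := by positivity
  have hE : ∀ y : ℝ, HasDerivAt (fun y : ℝ => Real.exp (-(r * y)))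
      (-(r * Real.exp (-(r * y)))) y := fun y => by
    simpa [mul_comm] using ((hasDerivAt_id y).const_mul r).fun_neg.exp
  have hftc := intervalIntegral.integral_eq_sub_of_hasDerivAt (a := 0) (b := x)
    (fun y _ => hasDerivAt_neg_sum_mul_pow_div_factorial hE m y)
    (Continuous.intervalIntegrable (by fun_prop) _ _)
  simp only [RCLike.ofReal_real_eq_id, id_eq] at hftc
  rw [← integral_indicator_one measurableSet_Iic, integral_gammaMeasure hn' hr]
  calc _ = ∫ y in Set.Ioi 0, (Set.Iic x).indicator
          (fun y => r * (Real.exp (-(r * y)) * ((r * y) ^ m / (m.factorial : ℝ)))) y := by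
        refine setIntegral_congr_fun measurableSet_Ioi fun y hy => ?_
        simp only [Set.indicator_apply]
        split_ifs
        · rw [Nat.cast_add, Nat.cast_one, Real.Gamma_nat_eq_factorial, add_sub_cancel_right,
            Real.rpow_natCast, Real.rpow_add_one hr.ne', Real.rpow_natCast]
          simp
          ring
        · simp
    _ = ∫ y in (0 : ℝ)..x, r * (Real.exp (-(r * y)) * ((r * y) ^ m / (m.factorial : ℝ))) := by
        rw [setIntegral_indicator measurableSet_Iic, Set.Ioi_inter_Iic,
          intervalIntegral.integral_of_le hx]
    _ = _ := by
        rw [hftc]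
        simp [Finset.sum_range_succ']
        ring

/-- The integrands agree pointwise: tilting a gamma density by e^{-r₂x}x^τ adds r₂ to the rate and τ
to the shape. Hence no integrability of φ is required. -/
theorem integral_mul_exp_mul_pow_gammaMeasure {n τ : ℕ} (hn : 1 ≤ n) {r₁ r₂ : ℝ} (hr₁ : 0 < r₁)
    (hr₂ : 0 < r₂) (φ : ℝ → ℝ) :
    ∫ x, φ x * (Real.exp (-(r₂ * x)) * ((r₂ * x) ^ τ / (τ.factorial : ℝ))) ∂gammaMeasure n r₁ =
      Real.Gamma (n + τ : ℕ) * r₁ ^ n * r₂ ^ τ /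
        (Real.Gamma n * τ.factorial * (r₁ + r₂) ^ (n + τ)) *
        ∫ x, φ x ∂gammaMeasure (n + τ : ℕ) (r₁ + r₂) := by
  have hn' : (0 : ℝ) < n := by exact_mod_cast hn
  have hnτ : (0 : ℝ) < (n + τ : ℕ) := by positivity
  have hr : 0 < r₁ + r₂ := add_pos hr₁ hr₂
  rw [integral_gammaMeasure hn' hr₁, integral_gammaMeasure hnτ hr, ← integral_const_mul]
  refine setIntegral_congr_fun measurableSet_Ioi fun x hx => ?_
  have hx : 0 < x := hx
  have h1 : x ^ (((n + τ : ℕ) : ℝ) - 1) = x ^ ((n : ℝ) - 1) * x ^ τ := by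
    rw [← Real.rpow_natCast x τ, ← Real.rpow_add hx]
    congr 1
    push_cast
    ring
  have hG1 := (Real.Gamma_pos_of_pos hn').ne'
  have hG2 := (Real.Gamma_pos_of_pos hnτ).ne'
  simp only [smul_eq_mul, Real.rpow_natCast]
  rw [h1, show -((r₁ + r₂) * x) = -(r₁ * x) + -(r₂ * x) by ring, Real.exp_add, mul_pow]
  field_simp

theorem integral_comp_max_prod {μ₁ μ₂ : Measure ℝ} [IsProbabilityMeasure μ₁]
    [IsProbabilityMeasure μ₂] [NullSingletonClass μ₁] {φ : ℝ → ℝ} (h₁ : Integrable φ μ₁)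
    (h₂ : Integrable φ μ₂) :
    ∫ p, φ (max p.1 p.2) ∂μ₁.prod μ₂ =
      ∫ x, φ x * μ₂.real (Set.Iic x) ∂μ₁ + ∫ y, φ y * μ₁.real (Set.Iic y) ∂μ₂ := by
  have m₁ : MeasurableSet {p : ℝ × ℝ | p.2 ≤ p.1} := measurableSet_le measurable_snd measurable_fst
  have m₂ : MeasurableSet {p : ℝ × ℝ | p.1 < p.2} := measurableSet_lt measurable_fst measurable_snd
  have i₁ : Integrable ({p : ℝ × ℝ | p.2 ≤ p.1}.indicator fun p => φ p.1) (μ₁.prod μ₂) :=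
    (h₁.comp_fst μ₂).indicator m₁
  have i₂ : Integrable ({p : ℝ × ℝ | p.1 < p.2}.indicator fun p => φ p.2) (μ₁.prod μ₂) :=
    (h₂.comp_snd μ₁).indicator m₂
  have hsplit : ∀ p : ℝ × ℝ, φ (max p.1 p.2) =
      {p : ℝ × ℝ | p.2 ≤ p.1}.indicator (fun p => φ p.1) p +
        {p : ℝ × ℝ | p.1 < p.2}.indicator (fun p => φ p.2) p := fun p => by
    rcases le_or_gt p.2 p.1 with h | h
    · simp [h]
    · simp [h, h.le]
  simp_rw [hsplit]
  rw [integral_add i₁ i₂, integral_prod _ i₁, integral_prod_symm _ i₂]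
  congr 1
  · refine integral_congr_ae (ae_of_all _ fun x => ?_)
    simp only
    rw [← integral_indicator_one measurableSet_Iic, ← integral_const_mul]
    congr 1
    ext y
    simp [Set.indicator_apply]
  · refine integral_congr_ae (ae_of_all _ fun y => ?_)
    simp only
    -- Ties were assigned to the first variable, so the second region is strict; the absence of
    -- atoms in μ₁ makes up the difference.
    rw [measureReal_congr (Iio_ae_eq_Iic (μ := μ₁) (a := y)).symm,
      ← integral_indicator_one measurableSet_Iio, ← integral_const_mul]
    congr 1
    ext x
    simp [Set.indicator_apply]

theorem integral_mul_gammaMeasure_Iic {n₁ n₂ : ℕ} (hn₁ : 1 ≤ n₁) (hn₂ : 1 ≤ n₂) {r₁ r₂ : ℝ}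
    (hr₁ : 0 < r₁) (hr₂ : 0 < r₂) {φ : ℝ → ℝ} (hφ : Integrable φ (gammaMeasure n₁ r₁)) :
    ∫ x, φ x * (gammaMeasure n₂ r₂).real (Set.Iic x) ∂gammaMeasure n₁ r₁ =
      ∫ x, φ x ∂gammaMeasure n₁ r₁ - ∑ τ ∈ Finset.range n₂,
        Real.Gamma (n₁ + τ : ℕ) * r₁ ^ n₁ * r₂ ^ τ /
          (Real.Gamma n₁ * τ.factorial * (r₁ + r₂) ^ (n₁ + τ)) *
          ∫ x, φ x ∂gammaMeasure (n₁ + τ : ℕ) (r₁ + r₂) := by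
  have hintegrable : ∀ τ : ℕ, Integrable
      (fun x => φ x * (Real.exp (-(r₂ * x)) * ((r₂ * x) ^ τ / (τ.factorial : ℝ))))
      (gammaMeasure n₁ r₁) := fun τ => by
    refine Integrable.mono hφ
      (hφ.aestronglyMeasurable.mul (Continuous.aestronglyMeasurable (by fun_prop))) ?_
    filter_upwards [ae_pos_gammaMeasure n₁ r₁] with x hx
    have h0 : 0 ≤ r₂ * x := by positivity
    -- Each weight is a Poisson probability, hence at most 1, so φ dominates every term.
    have hle : Real.exp (-(r₂ * x)) * ((r₂ * x) ^ τ / (τ.factorial : ℝ)) ≤ 1 := by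
      rw [Real.exp_neg, inv_mul_le_one₀ (Real.exp_pos _)]
      exact Real.pow_div_factorial_le_exp _ h0 _
    rw [norm_mul, Real.norm_of_nonneg (r := Real.exp _ * _) (by positivity)]
    exact mul_le_of_le_one_right (norm_nonneg _) hle
  simp_rw [← integral_mul_exp_mul_pow_gammaMeasure hn₁ hr₁ hr₂]
  rw [← integral_finsetSum _ fun τ _ => hintegrable τ,
    ← integral_sub hφ (integrable_finsetSum _ fun τ _ => hintegrable τ)]
  refine integral_congr_ae ?_
  filter_upwards [ae_pos_gammaMeasure n₁ r₁] with x hx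
  rw [gammaMeasure_natCast_real_Iic hn₂ hr₂ hx.le, mul_sub, mul_one, Finset.mul_sum]

/-! ### Independence and joint law of the gains -/

theorem ProbabilityTheory.iIndepFun.indepFun_pi_of_disjoint_range {S ι α β E : Type*}
    [MeasurableSpace S] {μ : Measure S} [MeasurableSpace E] [Fintype α] [Fintype β]
    {f : ι → S → E} (hf : iIndepFun f μ) (hm : ∀ i, AEMeasurable (f i) μ) {e₁ : α → ι}
    {e₂ : β → ι} (he : ∀ a b, e₁ a ≠ e₂ b) :
    IndepFun (fun s a => f (e₁ a) s) (fun s b => f (e₂ b) s) μ := by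
  classical
  have hd : Disjoint (Finset.univ.image e₁) (Finset.univ.image e₂) := by
    rw [Finset.disjoint_left]
    simp only [Finset.mem_image, Finset.mem_univ, true_and]
    rintro _ ⟨a, rfl⟩ ⟨b, hb⟩
    exact he a b hb.symm
  exact (hf.indepFun_finset₀ _ _ hd hm).comp
    (φ := fun v a => v ⟨e₁ a, Finset.mem_image_of_mem _ (Finset.mem_univ a)⟩)
    (ψ := fun v b => v ⟨e₂ b, Finset.mem_image_of_mem _ (Finset.mem_univ b)⟩)
    (by fun_prop) (by fun_prop)

namespace NOMA.Params

variable (P : Params) {S : Type*}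

theorem hasLaw_gainPrimary [MeasurableSpace S] {μ : Measure S} {hp : S → ℂ} (hp_law : HasLaw hp stdComplexNormal μ) :
    HasLaw (P.gainPrimary hp) (gammaMeasure 1 P.Ωp⁻¹) μ :=
  (hasLaw_normSq_stdComplexNormal P.Ωp_pos).comp hp_law

theorem hasLaw_gain [MeasurableSpace S] {μ : Measure S} [IsProbabilityMeasure μ] {h : (u : User) → Fin (P.N u) → S → ℂ} (u : User)
    (h_law : ∀ i, HasLaw (h u i) stdComplexNormal μ) (h_indep : iIndepFun (h u) μ) :
    HasLaw (P.gain h u) (gammaMeasure (P.N u) (P.Ω u)⁻¹) μ :=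
  hasLaw_sum_gammaMeasure (P.N_pos u) (inv_pos.2 (P.Ω_pos u))
    (fun i => (hasLaw_normSq_stdComplexNormal (P.Ω_pos u)).comp (h_law i))
    (h_indep.comp (fun _ z => ‖(Real.sqrt (P.Ω u) : ℂ) * z‖ ^ 2) fun _ => by fun_prop)

theorem aemeasurable_link [MeasurableSpace S] {μ : Measure S} {hp : S → ℂ}
    {h : (u : User) → Fin (P.N u) → S → ℂ} (hp_law : HasLaw hp stdComplexNormal μ)
    (h_law : ∀ u i, HasLaw (h u i) stdComplexNormal μ) (k : Option (Σ u : User, Fin (P.N u))) :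
    AEMeasurable (k.elim hp (fun i => h i.1 i.2)) μ := by
  rcases k with _ | ⟨u, i⟩
  · exact hp_law.aemeasurable
  · exact (h_law u i).aemeasurable

theorem indepFun_gain_near_far [MeasurableSpace S] {μ : Measure S} {hp : S → ℂ}
    {h : (u : User) → Fin (P.N u) → S → ℂ} (hp_law : HasLaw hp stdComplexNormal μ)
    (h_law : ∀ u i, HasLaw (h u i) stdComplexNormal μ)
    (h_indep : iIndepFun
      (fun k : Option (Σ u : User, Fin (P.N u)) => k.elim hp (fun i => h i.1 i.2)) μ) :
    IndepFun (P.gain h .near) (P.gain h .far) μ := by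
  have hind := h_indep.indepFun_pi_of_disjoint_range (P.aemeasurable_link hp_law h_law)
    (e₁ := fun i : Fin (P.N .near) => some ⟨.near, i⟩)
    (e₂ := fun i : Fin (P.N .far) => some ⟨.far, i⟩) (by simp)
  simp only [Option.elim_some] at hind
  have hm : ∀ u, Measurable fun v : Fin (P.N u) → ℂ =>
      ∑ i, ‖(Real.sqrt (P.Ω u) : ℂ) * v i‖ ^ 2 := fun u => by fun_prop
  exact hind.comp (hm .near) (hm .far)

theorem indepFun_gains_gainPrimary [MeasurableSpace S] {μ : Measure S} {hp : S → ℂ}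
    {h : (u : User) → Fin (P.N u) → S → ℂ} (hp_law : HasLaw hp stdComplexNormal μ)
    (h_law : ∀ u i, HasLaw (h u i) stdComplexNormal μ)
    (h_indep : iIndepFun
      (fun k : Option (Σ u : User, Fin (P.N u)) => k.elim hp (fun i => h i.1 i.2)) μ) :
    IndepFun (fun s => (P.gain h .near s, P.gain h .far s)) (P.gainPrimary hp) μ := by
  have hind := h_indep.indepFun_pi_of_disjoint_range (P.aemeasurable_link hp_law h_law)
    (e₁ := Sum.elim (fun i : Fin (P.N .near) => some ⟨.near, i⟩)
      (fun i : Fin (P.N .far) => some ⟨.far, i⟩))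
    (e₂ := fun _ : Unit => none) (by simp)
  have hm : Measurable fun v : Fin (P.N .near) ⊕ Fin (P.N .far) → ℂ =>
      (∑ i, ‖(Real.sqrt (P.Ω .near) : ℂ) * v (.inl i)‖ ^ 2,
        ∑ i, ‖(Real.sqrt (P.Ω .far) : ℂ) * v (.inr i)‖ ^ 2) := by fun_prop
  have hmp : Measurable fun v : Unit → ℂ => ‖(Real.sqrt P.Ωp : ℂ) * v ()‖ ^ 2 := by fun_prop
  exact hind.comp hm hmp

theorem hasLaw_gains [MeasurableSpace S] {μ : Measure S} [IsProbabilityMeasure μ] {hp : S → ℂ}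
    {h : (u : User) → Fin (P.N u) → S → ℂ} (hp_law : HasLaw hp stdComplexNormal μ)
    (h_law : ∀ u i, HasLaw (h u i) stdComplexNormal μ)
    (h_indep : iIndepFun
      (fun k : Option (Σ u : User, Fin (P.N u)) => k.elim hp (fun i => h i.1 i.2)) μ) :
    HasLaw (fun s => ((P.gain h .near s, P.gain h .far s), P.gainPrimary hp s))
      (((gammaMeasure (P.N .near) (P.Ω .near)⁻¹).prod
        (gammaMeasure (P.N .far) (P.Ω .far)⁻¹)).prod (gammaMeasure 1 P.Ωp⁻¹)) μ := by
  have hgain : ∀ u, HasLaw (P.gain h u) (gammaMeasure (P.N u) (P.Ω u)⁻¹) μ := fun u =>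
    P.hasLaw_gain u (h_law u) (h_indep.precomp
      (g := fun i : Fin (P.N u) => some (⟨u, i⟩ : Σ u : User, Fin (P.N u)))
      fun i j hij => by simpa using hij)
  have hprob : ∀ u, IsProbabilityMeasure (gammaMeasure (P.N u) (P.Ω u)⁻¹) := fun u =>
    isProbabilityMeasure_gammaMeasure (by exact_mod_cast P.N_pos u) (inv_pos.2 (P.Ω_pos u))
  have hprobp := isProbabilityMeasure_gammaMeasure one_pos (inv_pos.2 P.Ωp_pos)
  have hnf := (P.indepFun_gain_near_far hp_law h_law h_indep).hasLaw_prod (hgain _) (hgain _)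
  exact (P.indepFun_gains_gainPrimary hp_law h_law h_indep).hasLaw_prod hnf
    (P.hasLaw_gainPrimary hp_law)

/-! ### The expectation for the strong user -/

theorem snrStrong_eq (hp : S → ℂ) (h : (u : User) → Fin (P.N u) → S → ℂ) (s : S) :
    P.snrStrong hp h s =
      P.as * P.Ihat * max (P.gain h .near s) (P.gain h .far s) / P.gainPrimary hp s := by
  have hmax : P.gain h (P.strongUser h s) s = max (P.gain h .near s) (P.gain h .far s) := by
    unfold strongUser
    split_ifs with hle
    · rw [max_eq_left hle]
    · rw [max_eq_right (not_le.1 hle).le]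
  rw [snrStrong, hmax, transmitPower, Ihat]
  ring

/-- No null set is excluded: where the primary gain vanishes, division by zero makes the SNR 0 and
the value 1. -/
theorem one_add_snrStrong_mem (hp : S → ℂ) (h : (u : User) → Fin (P.N u) → S → ℂ) (s : S) :
    (1 + P.snrStrong hp h s) ^ (-P.ν) ∈ Set.Ioc (0 : ℝ) 1 := by
  have hs : 0 ≤ P.snrStrong hp h s := by
    rw [snrStrong_eq]
    have h1 := P.as_pos
    have h2 := P.Ihat_pos
    have h3 : 0 ≤ P.gainPrimary hp s := sq_nonneg _
    have h4 : 0 ≤ P.gain h .near s := Finset.sum_nonneg fun _ _ => sq_nonneg _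
    have h5 := h4.trans (le_max_left _ (P.gain h .far s))
    positivity
  exact ⟨Real.rpow_pos_of_pos (by linarith) _,
    Real.rpow_le_one_of_one_le_of_nonpos (by linarith) (by linarith [P.ν_pos])⟩

/-- The expectation of `(1 + a_s Î g / g_p)^{-ν}` over `g_p ~ Exp(Ω_p)`. -/
noncomputable def condMean (g : ℝ) : ℝ :=
  ∫ p, (1 + P.as * P.Ihat * g / p) ^ (-P.ν) ∂gammaMeasure 1 P.Ωp⁻¹

theorem integrable_ratio_prod {X : Type*} [MeasurableSpace X] {ρ : Measure X}
    [IsProbabilityMeasure ρ] {g : X → ℝ} (hg : Measurable g) (hpos : ∀ᵐ x ∂ρ, 0 < g x) :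
    Integrable (fun q : X × ℝ => (1 + P.as * P.Ihat * g q.1 / q.2) ^ (-P.ν))
      (ρ.prod (gammaMeasure 1 P.Ωp⁻¹)) := by
  have := isProbabilityMeasure_gammaMeasure one_pos (inv_pos.2 P.Ωp_pos)
  refine Integrable.of_bound (Measurable.aestronglyMeasurable (by fun_prop)) 1 ?_
  filter_upwards [Measure.quasiMeasurePreserving_fst.ae hpos,
    Measure.quasiMeasurePreserving_snd.ae (ae_pos_gammaMeasure 1 P.Ωp⁻¹)] with q h1 h2
  have h3 := P.as_pos
  have h4 := P.Ihat_pos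
  have h5 : 0 ≤ P.as * P.Ihat * g q.1 / q.2 := by positivity
  rw [Real.norm_of_nonneg (by positivity)]
  exact Real.rpow_le_one_of_one_le_of_nonpos (by linarith) (by linarith [P.ν_pos])

theorem integral_ratio_prod {X : Type*} [MeasurableSpace X] {ρ : Measure X}
    [IsProbabilityMeasure ρ] {g : X → ℝ} (hg : Measurable g) (hpos : ∀ᵐ x ∂ρ, 0 < g x) :
    ∫ q : X × ℝ, (1 + P.as * P.Ihat * g q.1 / q.2) ^ (-P.ν) ∂(ρ.prod (gammaMeasure 1 P.Ωp⁻¹)) =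
      ∫ x, P.condMean (g x) ∂ρ := by
  have := isProbabilityMeasure_gammaMeasure one_pos (inv_pos.2 P.Ωp_pos)
  rw [integral_prod _ (P.integrable_ratio_prod hg hpos)]
  rfl

theorem integrable_condMean {a r : ℝ} (ha : 0 < a) (hr : 0 < r) :
    Integrable P.condMean (gammaMeasure a r) := by
  have := isProbabilityMeasure_gammaMeasure ha hr
  have := isProbabilityMeasure_gammaMeasure one_pos (inv_pos.2 P.Ωp_pos)
  exact (P.integrable_ratio_prod measurable_id (ae_pos_gammaMeasure a r)).integral_prod_left

theorem integral_condMean {k : ℕ} (hk : 1 ≤ k) {β : ℝ} (hβ : 0 < β) :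
    ∫ x, P.condMean x ∂gammaMeasure k β⁻¹ = P.meanRatio k β := by
  have := isProbabilityMeasure_gammaMeasure (a := k) (by exact_mod_cast hk) (inv_pos.2 hβ)
  exact (P.integral_ratio_prod measurable_id (ae_pos_gammaMeasure k β⁻¹)).symm

/-- This is the contribution of the event that the user with parameters α₁, β₁ is the strong one.
The summed rate being `Ωpair⁻¹` explains the harmonic combination of the path losses in T₂. -/
theorem integral_condMean_mul_Iic {α₁ α₂ : ℕ} (hα₁ : 1 ≤ α₁) (hα₂ : 1 ≤ α₂) {β₁ β₂ : ℝ}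
    (hβ₁ : 0 < β₁) (hβ₂ : 0 < β₂) (hΩ : β₁⁻¹ + β₂⁻¹ = P.Ωpair⁻¹) :
    ((∫ x, P.condMean x * (gammaMeasure α₂ β₂⁻¹).real (Set.Iic x) ∂gammaMeasure α₁ β₁⁻¹ : ℝ) : ℂ) =
      P.T₁ α₁ β₁ - P.T₂ α₁ α₂ β₁ β₂ := by
  rw [P.T₁_eq_meanRatio hα₁ hβ₁, P.T₂_eq_sum_meanRatio hα₁ hβ₁ hβ₂,
    integral_mul_gammaMeasure_Iic hα₁ hα₂ (inv_pos.2 hβ₁) (inv_pos.2 hβ₂)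
      (P.integrable_condMean (by exact_mod_cast hα₁) (inv_pos.2 hβ₁)), hΩ,
    P.integral_condMean hα₁ hβ₁, ← Complex.ofReal_sub]
  congr 2
  refine Finset.sum_congr rfl fun τ _ => ?_
  rw [P.integral_condMean (by omega) P.Ωpair_pos]
  congr 1
  have h1 := P.Ωpair_pos.ne'
  have h2 := (Real.Gamma_pos_of_pos (show (0 : ℝ) < α₁ by exact_mod_cast hα₁)).ne'
  simp only [inv_pow]
  field_simp

theorem integral_one_add_snrStrong [MeasurableSpace S] {μ : Measure S} [IsProbabilityMeasure μ] {hp : S → ℂ}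
    {h : (u : User) → Fin (P.N u) → S → ℂ} (hp_law : HasLaw hp stdComplexNormal μ)
    (h_law : ∀ u i, HasLaw (h u i) stdComplexNormal μ)
    (h_indep : iIndepFun
      (fun k : Option (Σ u : User, Fin (P.N u)) => k.elim hp (fun i => h i.1 i.2)) μ) :
    ((∫ s, (1 + P.snrStrong hp h s) ^ (-P.ν) ∂μ : ℝ) : ℂ) =
      P.T₁ (P.N .near) (P.Ω .near) + P.T₁ (P.N .far) (P.Ω .far)
        - P.T₂ (P.N .near) (P.N .far) (P.Ω .near) (P.Ω .far)
        - P.T₂ (P.N .far) (P.N .near) (P.Ω .far) (P.Ω .near) := by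
  have hN : ∀ u, (0 : ℝ) < P.N u := fun u => by exact_mod_cast P.N_pos u
  have hΩ : ∀ u, 0 < (P.Ω u)⁻¹ := fun u => inv_pos.2 (P.Ω_pos u)
  have hprob : ∀ u, IsProbabilityMeasure (gammaMeasure (P.N u) (P.Ω u)⁻¹) := fun u =>
    isProbabilityMeasure_gammaMeasure (hN u) (hΩ u)
  have := nullSingletonClass_gammaMeasure (P.N .near) (P.Ω .near)⁻¹
  have hlaw := P.hasLaw_gains hp_law h_law h_indep
  have hE : ∫ s, (1 + P.snrStrong hp h s) ^ (-P.ν) ∂μ =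
      ∫ q : (ℝ × ℝ) × ℝ, (1 + P.as * P.Ihat * max q.1.1 q.1.2 / q.2) ^ (-P.ν)
        ∂(((gammaMeasure (P.N .near) (P.Ω .near)⁻¹).prod
          (gammaMeasure (P.N .far) (P.Ω .far)⁻¹)).prod (gammaMeasure 1 P.Ωp⁻¹)) := by
    rw [← hlaw.integral_comp (Measurable.aestronglyMeasurable (by fun_prop))]
    simp only [snrStrong_eq, Function.comp_def]
  have hpair : (P.Ω .near)⁻¹ + (P.Ω .far)⁻¹ = P.Ωpair⁻¹ := by
    have h1 := (P.Ω_pos .near).ne'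
    have h2 := (P.Ω_pos .far).ne'
    rw [Ωpair]
    field_simp
    ring
  rw [hE, P.integral_ratio_prod (g := fun x : ℝ × ℝ => max x.1 x.2) (by fun_prop)
      ((ae_pos_prod_gammaMeasure (hN _) (hΩ _) (hN _) (hΩ _)).mono fun _ hx =>
        lt_max_of_lt_left hx.1),
    integral_comp_max_prod (P.integrable_condMean (hN _) (hΩ _))
      (P.integrable_condMean (hN _) (hΩ _)), Complex.ofReal_add,
    P.integral_condMean_mul_Iic (P.N_pos _) (P.N_pos _) (P.Ω_pos _) (P.Ω_pos _) hpair,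
    P.integral_condMean_mul_Iic (P.N_pos _) (P.N_pos _) (P.Ω_pos _) (P.Ω_pos _)
      (by rw [add_comm, hpair])]
  ring

end NOMA.Params

theorem theorem1 (P : NOMA.Params) {S : Type*} [MeasurableSpace S]
    (μ : Measure S) [IsProbabilityMeasure μ]
    -- normalized fading coefficients of the interference link and of the antennas of both users
    (hp : S → ℂ) (h : (u : NOMA.User) → Fin (P.N u) → S → ℂ)
    (hp_law : HasLaw hp NOMA.stdComplexNormal μ)
    (h_law : ∀ u i, HasLaw (h u i) NOMA.stdComplexNormal μ)
    -- all links fade independently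
    (h_indep : iIndepFun
      (fun k : Option (Σ u : NOMA.User, Fin (P.N u)) => k.elim hp (fun i => h i.1 i.2)) μ) :
    -- the expectation exists
    Integrable (fun s => (1 + P.snrStrong hp h s) ^ (-P.ν)) μ ∧
    -- all Meijer G-functions of the closed form are properly defined
    (∀ k : ℕ, 1 ≤ k → ∀ z : ℝ, 0 < z →
      NOMA.MeijerGDefined 2 2 (NOMA.Params.upperPar k) (P.lowerPar k) (z : ℂ)) ∧
    -- the closed form: a positive real number under the logarithm
    ∃ b : ℝ, 0 < b ∧
      (b : ℂ) = P.T₁ (P.N .near) (P.Ω .near) + P.T₁ (P.N .far) (P.Ω .far)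
        - P.T₂ (P.N .near) (P.N .far) (P.Ω .near) (P.Ω .far)
        - P.T₂ (P.N .far) (P.N .near) (P.Ω .far) (P.Ω .near) ∧
      P.effectiveRate μ (P.snrStrong hp h) = -(1 / P.ν) * Real.logb 2 b := by
  have hmem := P.one_add_snrStrong_mem hp h
  have hintegrable : Integrable (fun s => (1 + P.snrStrong hp h s) ^ (-P.ν)) μ := by
    have hlaw := P.hasLaw_gains hp_law h_law h_indep
    have hm : Measurable fun q : (ℝ × ℝ) × ℝ =>
        (1 + P.as * P.Ihat * max q.1.1 q.1.2 / q.2) ^ (-P.ν) := by fun_prop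
    refine Integrable.of_bound (C := 1) ?_ (ae_of_all _ fun s => ?_)
    · simp only [P.snrStrong_eq]
      exact (hm.comp_aemeasurable hlaw.aemeasurable).aestronglyMeasurable
    · rw [Real.norm_of_nonneg (hmem s).1.le]
      exact (hmem s).2
  refine ⟨hintegrable, fun k hk z hz => P.meijerGDefined hk hz,
    ∫ s, (1 + P.snrStrong hp h s) ^ (-P.ν) ∂μ, ?_,
    P.integral_one_add_snrStrong hp_law h_law h_indep, rfl⟩
  -- The integrand is positive everywhere, so its support has measure 1 and the bracket is positive.
  rw [integral_pos_iff_support_of_nonneg (fun s => (hmem s).1.le) hintegrable,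
    Function.support_eq_univ fun s => (hmem s).1.ne', measure_univ]
  exact one_pos
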